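/- Let $L$ be the lollipop: a circle $L_{\circ}$ together with a segment $L_{|}$ (the stick) that meets the circle exactly in one endpoint $P$ of the segment. Let $G$ be a finite graph. A \emph{lollipop model} of $G$ is a map $\phi$ that assigns to every vertex a non-empty connected subset of $L$ so that distinct vertices $u,v$ are adjacent if and only if $\phi(u)\cap\phi(v)\neq\emptyset$. Let $C\subseteq V(G)$ and let $\mathcal{I}$ be the set of connected components of $G-C$ (identified with their vertex sets). For $I\in\mathcal{I}$ let $N_C(I)$ (respectively $N^s_C(I)$) be the set of vertices of $C$ adjacent to some (respectively every) vertex of $I$, and put $C(I)=C\setminus N^s_C(I)$ and $C^s(I)=C\setminus N_C(I)$. The component $I$ is \emph{ambiguous} if $G[C\cup I]$ has an interval model on the real line in which $C$ is the left-most clique, i.e. for some point $p$ the vertices whose intervals contain $p$ are exactly those of $C$, and no interval has a point to the left of $p$. Let $\mathcal{I}_a$ be the set of ambiguous components. For $I,J\in\mathcal{I}_a$ write $I\sqsubset J$ if $I\neq J$ and $C(I)\subseteq C^s(J)$, and let $\sqsubseteq$ be the reflexive closure of $\sqsubset$. (The relation $\sqsubseteq$ is always a preorder, and it is a partial order if no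 two distinct ambiguous components $I,J$ with $N_C(I)=N^s_C(I)$ and $N_C(J)=N^s_C(J)$ satisfy $C(I)=C(J)$.) Suppose $\phi$ is a lollipop model of $G$ with $\{v : P\in\phi(v)\}=C$ (so $C$ is a clique), and write $\phi(I)=\bigcup_{v\in I}\phi(v)$. Let $\mathcal{I}^{\phi}_{\circ}$ and $\mathcal{I}^{\phi}_{\text{stick}}$ be the sets of components $I$ with $\phi(I)\subseteq L_{\circ}\setminus\{P\}$ and $\phi(I)\subseteq L_{|}\setminus\{P\}$, respectively. For $c\in C$ let $\phi^*(c)$ be the shortest interval of $L_{\circ}\setminus\{P\}$ that contains $\phi(I)$ for every $I\in\mathcal{I}^{\phi}_{\circ}$ with $c\in C(I)$ (empty if there is no such $I$). For a graph $H$ with $V(H)\subseteq C$, the model $\phi$ is \emph{$(C,H)$-centered} if $V(H)=\{c\in C:\phi^*(c)\neq\emptyset\}$ and distinct $u,v\in V(H)$ are adjacent in $H$ if and only if $\phi^*(u)\cap\phi^*(v)\neq\emptyset$. \textbf{Lemma.} For every graph $H$ and every $(C,H)$-centered model $\phi$ of $G$, we have $\mathcal{I}^{\phi}_{\text{stick}}\subseteq\mathcal{I}_a$,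 and $\mathcal{I}^{\phi}_{\text{stick}}$ is a chain in $(\mathcal{I}_a,\sqsubseteq)$: any two of its members are $\sqsubseteq$-comparable. The same conclusion holds for every lollipop model $\phi$ of $G$ with $\{v:P\in\phi(v)\}=C$, whether or not the intervals $\phi^*(c)$ represent a prescribed graph $H$. -/

import Mathlib

namespace Lollipop

/-- The branching point `P` of the lollipop. -/
def center : ℂ := 1

/-- The circle of the lollipop. -/
def circle : Set ℂ := {z : ℂ | ‖z‖ = 1}

/-- The stick of the lollipop: a segment that meets the circle exactly in `P`. -/
def stick : Set ℂ := segment ℝ (1 : ℂ) 2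

/-- The lollipop, a circle with a segment attached to it, drawn in the plane. -/
def lollipop : Set ℂ := circle ∪ stick

variable {V : Type*}

/-- `φ` is a lollipop model of `G`: every vertex is represented by a non-empty connected subset of
the lollipop, and `G` is the intersection graph of these sets. -/
structure IsModel (G : SimpleGraph V) (φ : V → Set ℂ) : Prop where
  subset : ∀ v, φ v ⊆ lollipop
  connected : ∀ v, IsConnected (φ v)
  adj_iff : ∀ u v, u ≠ v → (G.Adj u v ↔ (φ u ∩ φ v).Nonempty)

/-- The lollipop model `φ` is centered at `C`: exactly the vertices of `C` are represented by sets
that contain the branching point `P` (in particular `C` is a clique of `G`). -/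
structure IsCenteredAt (G : SimpleGraph V) (C : Set V) (φ : V → Set ℂ) : Prop
    extends IsModel G φ where
  center_mem_iff : ∀ v, center ∈ φ v ↔ v ∈ C

/-- The set of the connected components of `G - C`. -/
abbrev Component (G : SimpleGraph V) (C : Set V) : Type _ :=
  (G.induce Cᶜ).ConnectedComponent

section Components

variable {G : SimpleGraph V} {C : Set V}

/-- The vertex set of a component of `G - C`, as a set of vertices of `G`. -/
def verts (I : Component G C) : Set V := Subtype.val '' I.supp

/-- `N_C(I)`: the vertices of `C` adjacent to some vertex of `I`. -/
def nbr (I : Component G C) : Set V := {c | c ∈ C ∧ ∃ v ∈ verts I, G.Adj c v}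

/-- `N^s_C(I)`: the vertices of `C` adjacent to all vertices of `I`. -/
def strongNbr (I : Component G C) : Set V := {c | c ∈ C ∧ ∀ v ∈ verts I, G.Adj c v}

/-- `C(I) = C \ N^s_C(I)`. -/
def cl (I : Component G C) : Set V := C \ strongNbr I

/-- `C^s(I) = C \ N_C(I)`. -/
def clStrong (I : Component G C) : Set V := C \ nbr I

/-- `I` is ambiguous: `G[C ∪ I]` has an interval model on the real line in which `C` is the
left-most clique, that is, `C` is the set of the vertices whose intervals contain some point `p`,
and no interval has a point to the left of `p`. -/
def IsAmbiguous (I : Component G C) : Prop :=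
  ∃ ψ : ↥(C ∪ verts I) → Set ℝ,
    (∀ v, (ψ v).Nonempty ∧ (ψ v).OrdConnected) ∧
    (∀ u v : ↥(C ∪ verts I), u ≠ v → (G.Adj u v ↔ (ψ u ∩ ψ v).Nonempty)) ∧
    ∃ p : ℝ, (∀ v, p ∈ ψ v ↔ (v : V) ∈ C) ∧ ∀ v, ∀ x ∈ ψ v, p ≤ x

/-- `I` is simple: all its vertices have the same neighbours in `C`. -/
def IsSimple (I : Component G C) : Prop := nbr I = strongNbr I

variable (G C) in
/-- `𝓘_a`: the set of the ambiguous components. -/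
def ambiguous : Set (Component G C) := {I | IsAmbiguous I}

/-- `I ⊏ J`: `I` and `J` are distinct and `C(I) ⊆ C^s(J)`. -/
def SqSub (I J : Component G C) : Prop := I ≠ J ∧ cl I ⊆ clStrong J

/-- `I ⊑ J`, the reflexive closure of `⊏`. -/
def SqSubEq (I J : Component G C) : Prop := I = J ∨ SqSub I J

variable (G C) in
/-- The relation `⊑` on the set of the ambiguous components. -/
def ambiguousLE (I J : ambiguous G C) : Prop := SqSubEq I.1 J.1

/-- `φ(I)`, the part of the lollipop that the component `I` occupies. -/
def region (φ : V → Set ℂ) (I : Component G C) : Set ℂ := ⋃ v ∈ verts I, φ v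

variable (G C) in
/-- The set of the components that `φ` places on the circle. -/
def onCircle (φ : V → Set ℂ) : Set (Component G C) := {I | region φ I ⊆ circle \ {center}}

variable (G C) in
/-- The set of the components that `φ` places on the stick. -/
def onStick (φ : V → Set ℂ) : Set (Component G C) := {I | region φ I ⊆ stick \ {center}}

variable (G C) in
/-- `φ^*(c)`: the shortest interval of the circle without `P` that contains every component `I`
placed on the circle with `c ∈ C(I)`; it is empty if there is no such component. -/
def star (φ : V → Set ℂ) (c : V) : Set ℂ :=
  ⋂₀ {A : Set ℂ | A ⊆ circle \ {center} ∧ IsPreconnected A ∧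
    ∀ I ∈ onCircle G C φ, c ∈ cl I → region φ I ⊆ A}

lemma clStrong_subset_cl (I : Component G C) : clStrong I ⊆ cl I := by
  rintro c ⟨hc, hn⟩
  refine ⟨hc, fun hs => hn ⟨hc, ?_⟩⟩
  obtain ⟨v, hv⟩ := I.nonempty_supp
  exact ⟨v, ⟨v, hv, rfl⟩, hs.2 v ⟨v, hv, rfl⟩⟩

/-- `⊑` is a preorder. -/
instance ambiguousLE_isPreorder : IsPreorder (ambiguous G C) (ambiguousLE G C) where
  refl _ := Or.inl rfl
  trans := by
    rintro I J K (h | h) (h' | h')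
    · exact Or.inl (h.trans h')
    · exact Or.inr (by rw [h]; exact h')
    · exact Or.inr (by rw [← h']; exact h)
    · by_cases e : I.1 = K.1
      · exact Or.inl e
      · exact Or.inr ⟨e, h.2.trans ((clStrong_subset_cl _).trans h'.2)⟩

/-- `⊑` is a partial order as soon as no two ambiguous simple components are duplicates of each
other, that is, have the same set `C(I)`. -/
theorem ambiguousLE_isPartialOrder
    (h : ∀ I J : ambiguous G C, IsSimple I.1 → IsSimple J.1 → cl I.1 = cl J.1 → I = J) :
    IsPartialOrder (ambiguous G C) (ambiguousLE G C) where
  antisymm := by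
    rintro I J (e | e) (e' | e')
    · exact Subtype.ext e
    · exact Subtype.ext e
    · exact Subtype.ext e'.symm
    · have key : ∀ K : Component G C, cl K ⊆ clStrong K → IsSimple K := by
        intro K hK
        apply Set.Subset.antisymm
        · intro c hc
          by_contra hn
          exact (hK ⟨hc.1, hn⟩).2 hc
        · intro c hc
          by_contra hn
          exact (clStrong_subset_cl K ⟨hc.1, hn⟩).2 hc
      have h1 := e.2
      have h2 := e'.2
      have s1 := clStrong_subset_cl I.1
      have s2 := clStrong_subset_cl J.1
      exact h I J (key _ (h1.trans (s2.trans h2))) (key _ (h2.trans (s1.trans h1)))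
        (Set.Subset.antisymm (h1.trans s2) (h2.trans s1))

end Components

/-- `φ` is a `(C, H)`-centered model of `G`: it is centered at `C`, and the non-empty intervals
`φ^*(c)`, for `c` in `C`, form an interval model of the graph `H` with the vertex set `C'`. -/
structure IsCenteredModel (G : SimpleGraph V) (C : Set V) {C' : Set V} (H : SimpleGraph C')
    (φ : V → Set ℂ) : Prop extends IsCenteredAt G C φ where
  mem_iff : ∀ c, c ∈ C' ↔ c ∈ C ∧ (star G C φ c).Nonempty
  adj_iff_star : ∀ u v : C', u ≠ v → (H.Adj u v ↔ (star G C φ u ∩ star G C φ v).Nonempty)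

end Lollipop

namespace Lollipop

/-! Collapsing the circle to `P` retracts the lollipop onto the stick, an interval with left end
`P`. The retraction maps a set into itself if the set contains `P` or lies in the stick. For a
component `I` on the stick this covers all vertices of `C ∪ I`, so their images intersect exactly
when the original sets do: they form an interval model with `C` left-most, and `I` is ambiguous.

Two components on the stick occupy disjoint intervals. If `I` is the one nearer to `P`, then every
`c ∈ C` with a neighbour in `J` stretches from `P` across all of `I`, so it is adjacent to all of
`I`. Contrapositively, `C(I) ⊆ C^s(J)` (`cl_subset_clStrong`). -/

/-- The retraction of the lollipop to the stick, in the coordinate of the stick. -/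
def stickCoord (z : ℂ) : ℝ := max 1 z.re

lemma continuous_stickCoord : Continuous stickCoord :=
  continuous_const.max Complex.continuous_re

lemma one_le_stickCoord (z : ℂ) : 1 ≤ stickCoord z := le_max_left _ _

lemma stickCoord_center : stickCoord center = 1 := by simp [stickCoord, center]

lemma stickCoord_of_mem_stick {z : ℂ} (hz : z ∈ stick) : ((stickCoord z : ℝ) : ℂ) = z := by
  obtain ⟨a, b, ha, hb, hab, rfl⟩ := hz
  have h : stickCoord (a • (1 : ℂ) + b • (2 : ℂ)) = a + b * 2 := by
    simp only [stickCoord, Complex.add_re, Complex.real_smul, Complex.re_ofReal_mul,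
      Complex.ofReal_re, Complex.re_ofNat, mul_one]
    exact max_eq_right (by linarith)
  rw [h]
  simp

lemma stickCoord_of_mem_circle {z : ℂ} (hz : z ∈ circle) : stickCoord z = 1 :=
  max_eq_left ((Complex.re_le_norm z).trans (le_of_eq hz))

variable {V : Type*} {G : SimpleGraph V} {C : Set V} {φ : V → Set ℂ}

lemma IsCenteredAt.stickCoord_mem_of_mem (hφ : IsCenteredAt G C φ) {v : V} (hv : v ∈ C) {z : ℂ}
    (hz : z ∈ φ v) : ((stickCoord z : ℝ) : ℂ) ∈ φ v := by
  rcases hφ.subset v hz with h | h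
  · rw [stickCoord_of_mem_circle h]
    simpa [center] using (hφ.center_mem_iff v).2 hv
  · rwa [stickCoord_of_mem_stick h]

lemma mem_stick_of_mem_onStick {I : Component G C} (hI : I ∈ onStick G C φ) {v : V}
    (hv : v ∈ verts I) {z : ℂ} (hz : z ∈ φ v) : z ∈ stick :=
  (hI (Set.mem_biUnion hv hz)).1

lemma IsCenteredAt.stickCoord_mem (hφ : IsCenteredAt G C φ) {I : Component G C}
    (hI : I ∈ onStick G C φ) {v : V} (hv : v ∈ C ∪ verts I) {z : ℂ} (hz : z ∈ φ v) :
    ((stickCoord z : ℝ) : ℂ) ∈ φ v := by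
  rcases hv with hv | hv
  · exact hφ.stickCoord_mem_of_mem hv hz
  · rwa [stickCoord_of_mem_stick (mem_stick_of_mem_onStick hI hv hz)]

/-- If the images share a coordinate, the stick point with that coordinate lies in both sets, as
each is closed under the retraction. -/
lemma nonempty_image_stickCoord_inter_iff {A B : Set ℂ}
    (hA : ∀ z ∈ A, ((stickCoord z : ℝ) : ℂ) ∈ A) (hB : ∀ z ∈ B, ((stickCoord z : ℝ) : ℂ) ∈ B) :
    (stickCoord '' A ∩ stickCoord '' B).Nonempty ↔ (A ∩ B).Nonempty := by
  constructor
  · rintro ⟨x, ⟨z, hz, rfl⟩, w, hw, hwz⟩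
    exact ⟨_, hA z hz, hwz ▸ hB w hw⟩
  · rintro ⟨z, hz⟩
    exact ⟨_, ⟨z, hz.1, rfl⟩, z, hz.2, rfl⟩

lemma IsModel.ordConnected_image_stickCoord (hφ : IsModel G φ) (v : V) :
    (stickCoord '' φ v).OrdConnected :=
  ((hφ.connected v).isPreconnected.image _ continuous_stickCoord.continuousOn).ordConnected

theorem IsCenteredAt.onStick_subset_ambiguous (hφ : IsCenteredAt G C φ) :
    onStick G C φ ⊆ ambiguous G C := by
  intro I hI
  refine ⟨fun v => stickCoord '' φ v, fun v => ⟨(hφ.connected v).nonempty.image _,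
    hφ.ordConnected_image_stickCoord v⟩, fun u v huv => ?_, 1, fun v => ⟨?_, fun hv => ?_⟩, ?_⟩
  · rw [hφ.adj_iff u v fun h => huv (Subtype.ext h)]
    exact (nonempty_image_stickCoord_inter_iff (fun _ => hφ.stickCoord_mem hI u.2)
      fun _ => hφ.stickCoord_mem hI v.2).symm
  -- A point of coordinate `1` retracts to `P`, so `P` itself lies in `φ v`.
  · rintro ⟨z, hz, h⟩
    have := hφ.stickCoord_mem hI v.2 hz
    rw [h] at this
    exact (hφ.center_mem_iff v).1 (by simpa [center] using this)
  · exact ⟨center, (hφ.center_mem_iff v).2 hv, stickCoord_center⟩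
  · rintro v _ ⟨z, -, rfl⟩
    exact one_le_stickCoord z

lemma IsModel.isPreconnected_region (hφ : IsModel G φ) (I : Component G C) :
    IsPreconnected (region φ I) := by
  refine IsPreconnected.biUnion_of_reflTransGen (fun v _ => (hφ.connected v).isPreconnected) ?_
  rintro _ ⟨u, hu, rfl⟩ _ ⟨v, hv, rfl⟩
  obtain ⟨w⟩ : (G.induce Cᶜ).Reachable u v :=
    SimpleGraph.ConnectedComponent.exact (hu.trans hv.symm)
  -- The chain condition asks only that the source of each link lie in `I`; without `hv`, the
  -- induction hypothesis needs membership of the start of the walk alone.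
  clear hv
  induction w with
  | nil => exact .refl
  | @cons a b c h p ih =>
    have hb : b ∈ I.supp := (SimpleGraph.ConnectedComponent.sound h.reachable).symm.trans hu
    exact .head ⟨(hφ.adj_iff a b (G.ne_of_adj h)).1 h, ⟨a, hu, rfl⟩⟩ (ih hb)

lemma IsModel.disjoint_region (hφ : IsModel G φ) {I J : Component G C} (hIJ : I ≠ J) :
    Disjoint (region φ I) (region φ J) := by
  rw [Set.disjoint_left]
  intro z hI hJ
  obtain ⟨_, ⟨u, hu, rfl⟩, hzu⟩ := Set.mem_iUnion₂.1 hI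
  obtain ⟨_, ⟨v, hv, rfl⟩, hzv⟩ := Set.mem_iUnion₂.1 hJ
  apply hIJ
  rw [← show _ = I from hu, ← show _ = J from hv]
  by_cases h : u = v
  · rw [h]
  · refine SimpleGraph.ConnectedComponent.sound (SimpleGraph.Adj.reachable ?_)
    exact (hφ.adj_iff u v fun e => h (Subtype.ext e)).2 ⟨z, hzu, hzv⟩

/-- Two disjoint intervals of a linear order are comparable. -/
lemma forall_lt_or_forall_lt_of_disjoint {α : Type*} [LinearOrder α] {A B : Set α}
    (hA : A.OrdConnected) (hB : B.OrdConnected) (h : Disjoint A B) :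
    (∀ x ∈ A, ∀ y ∈ B, x < y) ∨ ∀ x ∈ B, ∀ y ∈ A, x < y := by
  by_contra! hc
  obtain ⟨⟨a, ha, b, hb, hba⟩, b', hb', a', ha', hab'⟩ := hc
  rw [Set.disjoint_left] at h
  -- Either `a' ≤ b ≤ a` puts `b` in `A`, or `b ≤ a' ≤ b'` puts `a'` in `B`.
  rcases le_total a' b with h1 | h1
  · exact h (hA.out ha' ha ⟨h1, hba⟩) hb
  · exact h ha' (hB.out hb hb' ⟨h1, hab'⟩)

lemma IsCenteredAt.cl_subset_clStrong (hφ : IsCenteredAt G C φ) {I J : Component G C}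
    (hI : I ∈ onStick G C φ)
    (h : ∀ x ∈ stickCoord '' region φ I, ∀ y ∈ stickCoord '' region φ J, x < y) :
    cl I ⊆ clStrong J := by
  rintro c ⟨hc, hcI⟩
  refine ⟨hc, ?_⟩
  rintro ⟨-, w, hw, hcw⟩
  refine hcI ⟨hc, fun v hv => ?_⟩
  have hvC : v ∉ C := by
    obtain ⟨v, -, rfl⟩ := hv
    exact v.2
  obtain ⟨z, hzc, hzw⟩ := (hφ.adj_iff c w (G.ne_of_adj hcw)).1 hcw
  obtain ⟨x, hx⟩ := (hφ.connected v).nonempty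
  have hlt := h _ ⟨x, Set.mem_biUnion hv hx, rfl⟩ _ ⟨z, Set.mem_biUnion hw hzw, rfl⟩
  -- The image of `φ c` is an interval from `1`, the coordinate of `P`, to a point of `J` beyond
  -- `x`, so it contains the coordinate of `x`.
  obtain ⟨y, hy, hyx⟩ := (hφ.ordConnected_image_stickCoord c).out
    ⟨center, (hφ.center_mem_iff c).2 hc, stickCoord_center⟩ ⟨z, hzc, rfl⟩
    ⟨one_le_stickCoord x, hlt.le⟩
  refine (hφ.adj_iff c v fun e => hvC (e ▸ hc)).2 ⟨x, ?_, hx⟩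
  rw [← stickCoord_of_mem_stick (mem_stick_of_mem_onStick hI hv hx), ← hyx]
  exact hφ.stickCoord_mem_of_mem hc hy

theorem IsCenteredAt.isChain_onStick (hφ : IsCenteredAt G C φ) :
    IsChain (ambiguousLE G C) {I | I.1 ∈ onStick G C φ} := by
  intro I hI J hJ hIJ
  have hne : I.1 ≠ J.1 := fun e => hIJ (Subtype.ext e)
  have hord (K : Component G C) : (stickCoord '' region φ K).OrdConnected :=
    ((hφ.isPreconnected_region K).image _ continuous_stickCoord.continuousOn).ordConnected
  have hdisj : Disjoint (stickCoord '' region φ I.1) (stickCoord '' region φ J.1) := by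
    rw [Set.disjoint_left]
    rintro _ ⟨z, hz, rfl⟩ ⟨w, hw, hwz⟩
    refine Set.disjoint_left.1 (hφ.disjoint_region hne) hz ?_
    -- On the stick the coordinate determines the point, so `z = w`.
    rwa [← stickCoord_of_mem_stick (hI hz).1, ← hwz, stickCoord_of_mem_stick (hJ hw).1]
  rcases forall_lt_or_forall_lt_of_disjoint (hord I.1) (hord J.1) hdisj with h | h
  · exact .inl (.inr ⟨hne, hφ.cl_subset_clStrong hI h⟩)
  · exact .inr (.inr ⟨hne.symm, hφ.cl_subset_clStrong hJ h⟩)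

end Lollipop

theorem mainTheorem3 {V : Type*} [Finite V] (G : SimpleGraph V) (C : Set V) :
    (∀ (C' : Set V) (H : SimpleGraph C') (φ : V → Set ℂ), Lollipop.IsCenteredModel G C H φ →
      Lollipop.onStick G C φ ⊆ Lollipop.ambiguous G C ∧
        IsChain (Lollipop.ambiguousLE G C) {I | I.1 ∈ Lollipop.onStick G C φ}) ∧
    (∀ φ : V → Set ℂ, Lollipop.IsCenteredAt G C φ →
      Lollipop.onStick G C φ ⊆ Lollipop.ambiguous G C ∧
        IsChain (Lollipop.ambiguousLE G C) {I | I.1 ∈ Lollipop.onStick G C φ}) :=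
  ⟨fun _ _ _ h => ⟨h.onStick_subset_ambiguous, h.isChain_onStick⟩,
    fun _ h => ⟨h.onStick_subset_ambiguous, h.isChain_onStick⟩⟩
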